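/- Let $\mathbb K$ be an algebraically closed field with a non-trivial rank one valuation $v:\mathbb K^*\to\mathbb R$, value group $\Gamma=v(\mathbb K^*)\subseteq\mathbb R$ (with the topology induced from $\mathbb R$) and residue field $k$. Fix a group homomorphism $\Gamma\to\mathbb K^*$, $\gamma\mapsto t^\gamma$, with $v(t^\gamma)=\gamma$. For $x\in\mathbb K^*$ put $T(x)=-v(x)\in\Gamma$ and let the principal coefficient $Pc(x)\in k^*$ be the residue class of $x\,t^{-v(x)}$; put $Pc(0)=0$. Let $T$ act coordinatewise on $(\mathbb K^*)^2$. A tropical polynomial $f=\max_{i\in I}\{a_i+i_1x+i_2y\}$ with finite non-empty support $I\subset\mathbb N^2$ and coefficients $a_i\in\Gamma$ defines the curve $\mathcal T(f)\subseteq\Gamma^2$ of points at which the maximum is attained for at least two indices. A lift of $f$ is a polynomial $\widetilde f=\sum_{i\in I}\widetilde a_i x^{i_1}y^{i_2}\in\mathbb K[x,y]$ with $\widetilde a_i\neq 0$ and $T(\widetilde a_i)=a_i$ for all $i\in I$. The stable intersection $C\cap_{st}D$ of two tropical curves is the limit set of $(C+u)\cap(D+w)$ as $(u,w)\to(0,0)$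 in $\Gamma^2\times\Gamma^2$ through the pairs for which $(C+u)\cap(D+w)$ is finite; that is, the set of points $q\in\Gamma^2$ each of whose neighborhoods meets $(C+u)\cap(D+w)$ for all sufficiently small such $(u,w)$. Let $f$ and $g$ be two such tropical polynomials in two variables, with supports $I$ and $J$. Then for lifts $\widetilde f=\sum_{i\in I}\widetilde a_i x^{i_1}y^{i_2}$ and $\widetilde g=\sum_{j\in J}\widetilde b_j x^{j_1}y^{j_2}$ with residually generic coefficients, the intersection of the algebraic curves projects into the stable intersection. Precisely: there is a non-zero polynomial $P$ over $k$ in variables indexed by $I\sqcup J$, depending only on $f$ and $g$ (for the fixed data $\mathbb K$, $v$, $t$), such that for all lifts $\widetilde f$ of $f$ and $\widetilde g$ of $g$ with $P\big((Pc(\widetilde a_i))_{i\in I},(Pc(\widetilde b_j))_{j\in J}\big)\neq0$, \[T\big(\{x\in(\mathbb K^*)^2:\widetilde f(x)=\widetilde g(x)=0\}\big)\subseteq\mathcal T(f)\cap_{st}\mathcal T(g).\] -/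

import Mathlib

open scoped Topology

noncomputable section

namespace TropicalPlane

/-! ### Valued fields: value group, residue field, tropicalization, principal coefficient -/

section Valued

variable {K : Type*} [Field K]

/-- The value group `Γ = v(K^*) ⊆ ℝ` of a real valuation (`v x = ⊤` exactly for `x = 0`). -/
def valueGroup (v : AddValuation K (WithTop ℝ)) : AddSubgroup ℝ where
  carrier := {r | ∃ x : K, v x = (r : WithTop ℝ)}
  zero_mem' := ⟨1, by simp⟩
  add_mem' := by
    rintro a b ⟨x, hx⟩ ⟨y, hy⟩
    exact ⟨x * y, by rw [v.map_mul, hx, hy, WithTop.coe_add]⟩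
  neg_mem' := by
    rintro a ⟨x, hx⟩
    exact ⟨x⁻¹, by rw [v.map_inv, hx]; rfl⟩

/-- The valuation ring `{x | 0 ≤ v x}`. -/
def valuationRing (v : AddValuation K (WithTop ℝ)) : ValuationSubring K where
  carrier := {x | 0 ≤ v x}
  mul_mem' := by
    intro a b ha hb
    simp only [Set.mem_ofPred_eq, v.map_mul] at *
    exact add_nonneg ha hb
  one_mem' := by simp
  add_mem' := by
    intro a b ha hb
    exact v.map_le_add ha hb
  zero_mem' := by simp
  neg_mem' := by
    intro a ha
    simpa using ha
  mem_or_inv_mem' := by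
    intro x
    simp only [Set.mem_ofPred_eq, v.map_inv]
    rcases hx : v x with _ | r
    · left; exact le_top
    · rcases le_total 0 r with h | h
      · left; exact WithTop.coe_le_coe.mpr h
      · right; exact WithTop.coe_le_coe.mpr (neg_nonneg.mpr h)

/-- The residue field `k` of `K`. -/
abbrev ResidueField (v : AddValuation K (WithTop ℝ)) : Type _ :=
  IsLocalRing.ResidueField (valuationRing v)

theorem val_ne_top (v : AddValuation K (WithTop ℝ)) (x : Kˣ) : v (x : K) ≠ ⊤ :=
  v.ne_top_iff.mpr x.ne_zero

/-- The tropicalization map `T(x) = -v(x)`, from `K^*` to `Γ`. -/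
def trop (v : AddValuation K (WithTop ℝ)) (x : Kˣ) : valueGroup v :=
  -⟨(v (x : K)).untop (val_ne_top v x), x, (WithTop.coe_untop _ _).symm⟩

/-- A choice of a multiplicative subgroup of `K^*` mapped isomorphically onto `Γ` by `v`, given by
the inverse isomorphism `γ ↦ t^γ`. -/
structure MonomialGroup (v : AddValuation K (WithTop ℝ)) where
  /-- `γ ↦ t^γ` -/
  t : Multiplicative (valueGroup v) →* Kˣ
  val_t : ∀ γ : valueGroup v, v (t (Multiplicative.ofAdd γ) : K) = ((γ : ℝ) : WithTop ℝ)

theorem unitPart_mem {v : AddValuation K (WithTop ℝ)} (M : MonomialGroup v) (x : Kˣ) :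
    (x : K) * M.t (Multiplicative.ofAdd (trop v x)) ∈ valuationRing v := by
  change 0 ≤ v _
  rw [v.map_mul, M.val_t]
  have h : v (x : K) = (((v (x : K)).untop (val_ne_top v x) : ℝ) : WithTop ℝ) :=
    (WithTop.coe_untop _ _).symm
  rw [h, ← WithTop.coe_add]
  exact WithTop.coe_le_coe.mpr (by simp [trop])

open Classical in
/-- The principal coefficient: if `x = x₀ t^γ` with `v x₀ = 0`, then `Pc x` is the residue class
of `x₀ = x t^(-γ)`; and `Pc 0 = 0`. -/
def principalCoeff {v : AddValuation K (WithTop ℝ)} (M : MonomialGroup v) (x : K) :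
    ResidueField v :=
  if hx : x = 0 then 0
  else IsLocalRing.residue (valuationRing v) ⟨_, unitPart_mem M (Units.mk0 x hx)⟩

end Valued

/-! ### Tropical plane curves -/

/-- A tropical polynomial in two variables with (finite, nonempty) support and coefficients
in `Γ`: it is the function `max_{i ∈ support} (a_i + i₀ x₀ + i₁ x₁)`. -/
structure TropPoly (Γ : AddSubgroup ℝ) where
  support : Finset (Fin 2 →₀ ℕ)
  nonempty : support.Nonempty
  coeff : support → Γ

namespace TropPoly

variable {Γ : AddSubgroup ℝ}

/-- The value at `q` of the tropical monomial of index `i`. -/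
def term (f : TropPoly Γ) (i : f.support) (q : Fin 2 → Γ) : Γ :=
  f.coeff i + ∑ m, (i : Fin 2 →₀ ℕ) m • q m

/-- The index `i` attains the maximum `f(q)`. -/
def Attains (f : TropPoly Γ) (q : Fin 2 → Γ) (i : f.support) : Prop :=
  ∀ j, f.term j q ≤ f.term i q

/-- The tropical curve `𝒯(f) ⊆ Γ²`: the maximum is attained for at least two indices. -/
def zeros (f : TropPoly Γ) : Set (Fin 2 → Γ) :=
  {q | ∃ i j, i ≠ j ∧ f.Attains q i ∧ f.Attains q j}

end TropPoly

/-- The translate of a set by a vector. -/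
def translate {Γ : AddSubgroup ℝ} (v : Fin 2 → Γ) (C : Set (Fin 2 → Γ)) : Set (Fin 2 → Γ) :=
  (fun q => v + q) '' C

/-- Pairs of translation vectors for which the translated curves meet in finitely many points. -/
def genericTranslations {Γ : AddSubgroup ℝ} (C D : Set (Fin 2 → Γ)) :
    Set ((Fin 2 → Γ) × (Fin 2 → Γ)) :=
  {p | (translate p.1 C ∩ translate p.2 D).Finite}

/-- The stable intersection, i.e. the limit set of `C^v ∩ D^w` as `(v, w)` tends to `(0, 0)` through
the pairs with finite `C^v ∩ D^w`: a point belongs to it if each of its neighborhoods meets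
`C^v ∩ D^w` for all sufficiently small such `(v, w)`. The topology on `Γ` is induced from `ℝ`. -/
def stableIntersection {Γ : AddSubgroup ℝ} (C D : Set (Fin 2 → Γ)) : Set (Fin 2 → Γ) :=
  {q | ∀ U ∈ 𝓝 q, ∀ᶠ p in 𝓝[genericTranslations C D] (0, 0),
    (translate p.1 C ∩ translate p.2 D ∩ U).Nonempty}

/-! ### Lifts and algebraic curves in the torus -/

section Lift

variable {K : Type*} [Field K]

/-- `F` is a lift of `f`: same support, and `T(coeff_i F) = a_i` for `i` in the support. -/
def IsLift (v : AddValuation K (WithTop ℝ)) (f : TropPoly (valueGroup v))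
    (F : MvPolynomial (Fin 2) K) : Prop :=
  F.support = f.support ∧
    ∀ (i : f.support) (a : Kˣ), (a : K) = F.coeff i → trop v a = f.coeff i

/-- The curve defined by `F` in the torus `(K^*)²`. -/
def torusCurve (F : MvPolynomial (Fin 2) K) : Set (Fin 2 → Kˣ) :=
  {x | MvPolynomial.eval (fun m => (x m : K)) F = 0}

/-- Coordinatewise tropicalization `(K^*)² → Γ²`. -/
def tropPoint (v : AddValuation K (WithTop ℝ)) (x : Fin 2 → Kˣ) : Fin 2 → valueGroup v :=
  fun m => trop v (x m)

/-- The vector of principal coefficients of the coefficients of the pair `(F, G)`, indexed by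
the disjoint union of the supports `I` and `J`. -/
def residualCoeffs {v : AddValuation K (WithTop ℝ)} (M : MonomialGroup v)
    (I J : Finset (Fin 2 →₀ ℕ)) (F G : MvPolynomial (Fin 2) K) : I ⊕ J → ResidueField v :=
  Sum.elim (fun i => principalCoeff M (F.coeff i)) (fun j => principalCoeff M (G.coeff j))

end Lift

end TropicalPlane

end

/-! Let q = T(x) for a common zero x, and call the indices attaining the maximum at q the initial
supports of f and g there. The argument splits on whether these lie on parallel lines.

If some difference in one is not parallel to some difference in the other, q is stable
(`mem_stableIntersection_of_cross_ne_zero`): after any small translation the curves still meet near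
q. Such a point is found on a ray from q inside 𝒯(g), at the first parameter where two monomials of
the translated f tie. Its coordinates must lie in Γ, which is divisible because K is algebraically
closed.

If all differences are parallel, reduction to k (`sum_principalCoeff_eq_zero`) makes Pc(x) a common
torus zero of the two initial forms. Up to monomials these are polynomials in one variable z, so a
resultant in the principal coefficients vanishes (`exists_ne_zero_of_common_zero`). Finitely many
pairs of initial supports are possible; P is the product of their resultants, so P ≠ 0 excludes this
case. -/

namespace TropicalPlane

/-! ### Univariate and parallel supports: elimination -/

section Elimination

variable {k σ τ : Type*} [Field k]

/-- Two generic univariate polynomials with prescribed supports have no common root, if the first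
support contains a positive exponent and the second one contains `0`. -/
theorem exists_ne_zero_of_common_root (A : Finset σ) (B : Finset τ) (n : σ → ℕ) (m : τ → ℕ)
    {i₁ : σ} (hi₁ : i₁ ∈ A) (hn : ∀ i ∈ A, n i ≤ n i₁)
    (hpos : n i₁ ≠ 0) {j₀ : τ} (hj₀ : j₀ ∈ B) (hm : m j₀ = 0) :
    ∃ P : MvPolynomial (σ ⊕ τ) k, P ≠ 0 ∧ ∀ (a : σ ⊕ τ → k) (z : k),
      ∑ i ∈ A, a (Sum.inl i) * z ^ n i = 0 → ∑ j ∈ B, a (Sum.inr j) * z ^ m j = 0 →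
        MvPolynomial.eval a P = 0 := by
  classical
  let p : Polynomial (MvPolynomial (σ ⊕ τ) k) :=
    ∑ i ∈ A, Polynomial.C (MvPolynomial.X (Sum.inl i)) * Polynomial.X ^ n i
  let q : Polynomial (MvPolynomial (σ ⊕ τ) k) :=
    ∑ j ∈ B, Polynomial.C (MvPolynomial.X (Sum.inr j)) * Polynomial.X ^ m j
  have hp : p.natDegree ≤ n i₁ := Polynomial.natDegree_sum_le_of_forall_le _ _ fun i hi =>
    (Polynomial.natDegree_C_mul_X_pow_le _ _).trans (hn i hi)
  have hq : q.natDegree ≤ B.sup m := Polynomial.natDegree_sum_le_of_forall_le _ _ fun j hj =>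
    (Polynomial.natDegree_C_mul_X_pow_le _ _).trans (Finset.le_sup hj)
  -- The resultant is taken for fixed formal degrees, so it commutes with specialization even when
  -- leading coefficients vanish. Specializing to the pair z ^ n i₁ and 1 shows that it is non-zero.
  refine ⟨p.resultant q (n i₁) (B.sup m), fun h0 => ?_, fun a z hA hB => ?_⟩
  · let φ : σ ⊕ τ → k := Sum.elim (fun i => if i = i₁ then 1 else 0)
      (fun j => if j = j₀ then 1 else 0)
    have h := Polynomial.resultant_map_map p q (n i₁) (B.sup m) (MvPolynomial.eval φ)
    have hp' : p.map (MvPolynomial.eval φ) = Polynomial.X ^ n i₁ := by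
      simp [p, φ, Polynomial.map_sum, hi₁, ite_mul]
    have hq' : q.map (MvPolynomial.eval φ) = 1 := by
      simp [q, φ, Polynomial.map_sum, hj₀, ite_mul, hm]
    rw [h0, hp', hq'] at h
    simp at h
  -- The resultant lies in the ideal (p, q); this needs a positive formal degree, which is the role
  -- of `hpos`.
  · obtain ⟨s, t, -, -, h⟩ :=
      Polynomial.exists_mul_add_mul_eq_C_resultant p q hp hq (Or.inl hpos)
    have h' := congrArg (fun r => (r.map (MvPolynomial.eval a)).eval z) h
    have hp' : (p.map (MvPolynomial.eval a)).eval z = 0 := by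
      simpa [p, Polynomial.map_sum, Polynomial.eval_finsetSum] using hA
    have hq' : (q.map (MvPolynomial.eval a)).eval z = 0 := by
      simpa [q, Polynomial.map_sum, Polynomial.eval_finsetSum] using hB
    simpa [hp', hq'] using h'.symm

/-- The integer vectors parallel to a non-zero vector are multiples of a single one, with a
linear coordinate. -/
theorem exists_coordinate_of_parallel {e₀ e₁ : ℤ} (he : e₀ ≠ 0 ∨ e₁ ≠ 0) :
    ∃ a b d₀ d₁ : ℤ, ∀ x y : ℤ, x * e₁ = y * e₀ →
      x = (a * x + b * y) * d₀ ∧ y = (a * x + b * y) * d₁ := by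
  have hg : (Int.gcd e₀ e₁ : ℤ) ≠ 0 := by
    rw [Ne, Int.natCast_eq_zero, Int.gcd_eq_zero_iff]; tauto
  obtain ⟨d₀, h₀⟩ := Int.gcd_dvd_left e₀ e₁
  obtain ⟨d₁, h₁⟩ := Int.gcd_dvd_right e₀ e₁
  have hb := Int.gcd_eq_gcd_ab e₀ e₁
  generalize Int.gcdA e₀ e₁ = a at hb
  generalize Int.gcdB e₀ e₁ = b at hb
  generalize (Int.gcd e₀ e₁ : ℤ) = c at *
  subst h₀ h₁
  have hb' : 1 = d₀ * a + d₁ * b := mul_left_cancel₀ hg (by linarith)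
  refine ⟨a, b, d₀, d₁, fun x y h => ?_⟩
  have hxy : x * d₁ = y * d₀ := mul_left_cancel₀ hg (by linarith)
  constructor
  · linear_combination x * hb' + b * hxy
  · linear_combination y * hb' - a * hxy

/-- The cross product of two differences of exponents. -/
def cross (i i' j j' : Fin 2 →₀ ℕ) : ℤ :=
  ((i 0 : ℤ) - i' 0) * ((j 1 : ℤ) - j' 1) - ((i 1 : ℤ) - i' 1) * ((j 0 : ℤ) - j' 0)

/-- Evaluating a Laurent monomial at a point of the torus, along a lattice line. -/
theorem prod_pow_eq_of_line {y : Fin 2 → k} (hy : ∀ m, y m ≠ 0) {i i' : Fin 2 →₀ ℕ} {d₀ d₁ : ℤ}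
    {n : ℕ} (h₀ : (i 0 : ℤ) - i' 0 = n * d₀) (h₁ : (i 1 : ℤ) - i' 1 = n * d₁) :
    ∏ m, y m ^ i m = (∏ m, y m ^ i' m) * (y 0 ^ d₀ * y 1 ^ d₁) ^ n := by
  have key : ∀ (x : k) (a b : ℕ) (d : ℤ), x ≠ 0 → (a : ℤ) - b = n * d →
      x ^ a = x ^ b * (x ^ d) ^ n := by
    intro x a b d hx h
    rw [← zpow_natCast x a, ← zpow_natCast x b, ← zpow_natCast (x ^ d), ← zpow_mul, ← zpow_add₀ hx]
    congr 1
    linarith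
  rw [Fin.prod_univ_two, Fin.prod_univ_two, key _ _ _ _ (hy 0) h₀, key _ _ _ _ (hy 1) h₁]
  ring

/-- Two generic polynomials with supports on parallel lines have no common zero in the torus. -/
theorem exists_ne_zero_of_common_zero {I J : Finset (Fin 2 →₀ ℕ)} (A : Finset I) (B : Finset J)
    (hA : A.Nonempty) (hB : B.Nonempty)
    (h : ∀ i ∈ A, ∀ i' ∈ A, ∀ j ∈ B, ∀ j' ∈ B, cross i i' j j' = 0) :
    ∃ P : MvPolynomial (I ⊕ J) k, P ≠ 0 ∧ ∀ (a : I ⊕ J → k) (y : Fin 2 → k), (∀ m, y m ≠ 0) →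
      ∑ i ∈ A, a (Sum.inl i) * ∏ m, y m ^ (i : Fin 2 →₀ ℕ) m = 0 →
      ∑ j ∈ B, a (Sum.inr j) * ∏ m, y m ^ (j : Fin 2 →₀ ℕ) m = 0 → MvPolynomial.eval a P = 0 := by
  classical
  -- A single monomial has no torus zero unless its coefficient is zero, so the coefficient itself
  -- serves as P.
  rcases hA.exists_eq_singleton_or_nontrivial with ⟨i, rfl⟩ | hA'
  · refine ⟨MvPolynomial.X (Sum.inl i), MvPolynomial.X_ne_zero _, fun a y hy h₁ _ => ?_⟩
    simpa [hy] using h₁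
  rcases hB.exists_eq_singleton_or_nontrivial with ⟨j, rfl⟩ | hB'
  · refine ⟨MvPolynomial.X (Sum.inr j), MvPolynomial.X_ne_zero _, fun a y hy _ h₂ => ?_⟩
    simpa [hy] using h₂
  have diff : ∀ {S : Finset (Fin 2 →₀ ℕ)} {i i' : S}, i ≠ i' →
      ((i : Fin 2 →₀ ℕ) 0 : ℤ) - (i' : Fin 2 →₀ ℕ) 0 ≠ 0 ∨
      ((i : Fin 2 →₀ ℕ) 1 : ℤ) - (i' : Fin 2 →₀ ℕ) 1 ≠ 0 := by
    intro S i i' hne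
    by_contra! hc
    refine hne (Subtype.ext (Finsupp.ext fun m => ?_))
    fin_cases m
    · simpa [sub_eq_zero] using hc.1
    · simpa [sub_eq_zero] using hc.2
  obtain ⟨i₂, hi₂, i₃, hi₃, hi⟩ := hA'
  obtain ⟨j₂, hj₂, j₃, hj₃, hj⟩ := hB'
  obtain ⟨a, b, d₀, d₁, hd⟩ := exists_coordinate_of_parallel (diff hj)
  let ℓ : (Fin 2 →₀ ℕ) → ℤ := fun i => a * i 0 + b * i 1
  have lineA : ∀ i ∈ A, ∀ i' ∈ A,
      ((i : Fin 2 →₀ ℕ) 0 : ℤ) - (i' : Fin 2 →₀ ℕ) 0 = (ℓ i - ℓ i') * d₀ ∧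
      ((i : Fin 2 →₀ ℕ) 1 : ℤ) - (i' : Fin 2 →₀ ℕ) 1 = (ℓ i - ℓ i') * d₁ := by
    intro i hi i' hi'
    have h1 := hd _ _ (sub_eq_zero.mp (h i hi i' hi' j₂ hj₂ j₃ hj₃))
    have e : ℓ i - ℓ i' = a * (((i : Fin 2 →₀ ℕ) 0 : ℤ) - (i' : Fin 2 →₀ ℕ) 0) +
      b * (((i : Fin 2 →₀ ℕ) 1 : ℤ) - (i' : Fin 2 →₀ ℕ) 1) := by simp only [ℓ]; ring
    rwa [e]
  have lineB : ∀ j ∈ B, ∀ j' ∈ B,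
      ((j : Fin 2 →₀ ℕ) 0 : ℤ) - (j' : Fin 2 →₀ ℕ) 0 = (ℓ j - ℓ j') * d₀ ∧
      ((j : Fin 2 →₀ ℕ) 1 : ℤ) - (j' : Fin 2 →₀ ℕ) 1 = (ℓ j - ℓ j') * d₁ := by
    intro j hj j' hj'
    have e : ℓ j - ℓ j' = a * (((j : Fin 2 →₀ ℕ) 0 : ℤ) - (j' : Fin 2 →₀ ℕ) 0) +
      b * (((j : Fin 2 →₀ ℕ) 1 : ℤ) - (j' : Fin 2 →₀ ℕ) 1) := by simp only [ℓ]; ring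
    rw [e]
    refine hd _ _ ?_
    -- Differences within B are compared with one another through the non-zero vector i₂ - i₃,
    -- parallel to all of them.
    have h1 := h i₂ hi₂ i₃ hi₃ j hj j' hj'
    have h2 := h i₂ hi₂ i₃ hi₃ j₂ hj₂ j₃ hj₃
    have hne := diff hi
    unfold cross at h1 h2
    generalize ((i₂ : Fin 2 →₀ ℕ) 0 : ℤ) - (i₃ : Fin 2 →₀ ℕ) 0 = p₀ at *
    generalize ((i₂ : Fin 2 →₀ ℕ) 1 : ℤ) - (i₃ : Fin 2 →₀ ℕ) 1 = p₁ at *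
    rcases hne with hne | hne <;> apply mul_left_cancel₀ hne
    · linear_combination (((j : Fin 2 →₀ ℕ) 0 : ℤ) - (j' : Fin 2 →₀ ℕ) 0) * h2 -
        (((j₂ : Fin 2 →₀ ℕ) 0 : ℤ) - (j₃ : Fin 2 →₀ ℕ) 0) * h1
    · linear_combination (((j : Fin 2 →₀ ℕ) 1 : ℤ) - (j' : Fin 2 →₀ ℕ) 1) * h2 -
        (((j₂ : Fin 2 →₀ ℕ) 1 : ℤ) - (j₃ : Fin 2 →₀ ℕ) 1) * h1
  have injA : ∀ i ∈ A, ∀ i' ∈ A, ℓ i = ℓ i' → i = i' := by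
    intro i hi i' hi' e
    by_contra hne
    have h1 := lineA i hi i' hi'
    have h2 := diff hne
    simp only [e, sub_self, zero_mul] at h1
    tauto
  obtain ⟨i₀, hi₀, hmin⟩ := A.exists_min_image (fun i => ℓ i) hA
  obtain ⟨i₁, hi₁, hmax⟩ := A.exists_max_image (fun i => ℓ i) hA
  obtain ⟨j₀, hj₀, hminB⟩ := B.exists_min_image (fun j => ℓ j) hB
  have hpos : ℓ i₀ < ℓ i₁ := by
    refine lt_of_le_of_ne (hmin _ hi₁) fun e => hi (injA _ hi₂ _ hi₃ ?_)
    have := hmin _ hi₂; have := hmin _ hi₃; have := hmax _ hi₂; have := hmax _ hi₃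
    omega
  -- Dividing by the monomials of i₀ and j₀ leaves polynomials in z = y₀ ^ d₀ * y₁ ^ d₁ with natural
  -- exponents.
  obtain ⟨P, hP, hP'⟩ := exists_ne_zero_of_common_root (k := k) A B
    (fun i => (ℓ i - ℓ i₀).toNat) (fun j => (ℓ j - ℓ j₀).toNat) hi₁
    (fun i hi => by have := hmax i hi; omega)
    (by omega) hj₀ (by simp)
  refine ⟨P, hP, fun c y hy h₁ h₂ => hP' c (y 0 ^ d₀ * y 1 ^ d₁) ?_ ?_⟩
  · have hne : ∏ m, y m ^ (i₀ : Fin 2 →₀ ℕ) m ≠ 0 :=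
      Finset.prod_ne_zero_iff.mpr fun m _ => pow_ne_zero _ (hy m)
    refine mul_left_cancel₀ hne ?_
    rw [mul_zero, ← h₁, Finset.mul_sum]
    refine Finset.sum_congr rfl fun i hi => ?_
    have hl := lineA i hi i₀ hi₀
    have ht : (((ℓ i - ℓ i₀).toNat : ℕ) : ℤ) = ℓ i - ℓ i₀ :=
      Int.toNat_of_nonneg (sub_nonneg.mpr (hmin i hi))
    rw [← ht] at hl
    rw [prod_pow_eq_of_line hy hl.1 hl.2]
    ring
  · have hne : ∏ m, y m ^ (j₀ : Fin 2 →₀ ℕ) m ≠ 0 :=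
      Finset.prod_ne_zero_iff.mpr fun m _ => pow_ne_zero _ (hy m)
    refine mul_left_cancel₀ hne ?_
    rw [mul_zero, ← h₂, Finset.mul_sum]
    refine Finset.sum_congr rfl fun j hj => ?_
    have hl := lineB j hj j₀ hj₀
    have ht : (((ℓ j - ℓ j₀).toNat : ℕ) : ℤ) = ℓ j - ℓ j₀ :=
      Int.toNat_of_nonneg (sub_nonneg.mpr (hminB j hj))
    rw [← ht] at hl
    rw [prod_pow_eq_of_line hy hl.1 hl.2]
    ring

end Elimination

/-! ### Local geometry: transversal pairs of initial supports -/

section Geometry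

/-- Moving from a maximizing index of finitely many affine functions of one variable in a direction
in which another one grows faster, one reaches a first point where the maximum is attained twice. -/
theorem exists_breakpoint {G ι : Type*} [AddCommGroup G] [LinearOrder G] [IsOrderedAddMonoid G]
    (hdiv : ∀ n : ℤ, 0 < n → ∀ x : G, ∃ y : G, n • y = x) (S : Finset ι) (c : ι → G) (m : ι → ℤ)
    {i₀ : ι} (hmax : ∀ i ∈ S, c i ≤ c i₀) (hex : ∃ i ∈ S, m i₀ < m i) :
    ∃ s : G, 0 ≤ s ∧ ∃ i₁ ∈ S, m i₀ < m i₁ ∧ (m i₁ - m i₀) • s = c i₀ - c i₁ ∧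
      ∀ i ∈ S, c i + m i • s ≤ c i₀ + m i₀ • s := by
  classical
  -- s i is the time at which a steeper i catches up with i₀; the least such time is the breakpoint.
  have hs : ∀ i, ∃ s : G, m i₀ < m i → (m i - m i₀) • s = c i₀ - c i := by
    intro i
    by_cases h : m i₀ < m i
    · obtain ⟨s, hs⟩ := hdiv _ (sub_pos.mpr h) (c i₀ - c i)
      exact ⟨s, fun _ => hs⟩
    · exact ⟨0, fun h' => absurd h' h⟩
  choose s hs using hs
  obtain ⟨i, hi, hlt⟩ := hex
  obtain ⟨i₁, hi₁, hmin⟩ := (S.filter fun i => m i₀ < m i).exists_min_image s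
    ⟨i, Finset.mem_filter.mpr ⟨hi, hlt⟩⟩
  obtain ⟨hi₁, hlt₁⟩ := Finset.mem_filter.mp hi₁
  have h0 : 0 ≤ s i₁ := by
    by_contra! hneg
    have hpos := zsmul_pos (neg_pos.mpr hneg) (sub_pos.mpr hlt₁)
    rw [smul_neg, hs _ hlt₁, neg_sub, sub_pos] at hpos
    exact absurd (hmax _ hi₁) (not_le.mpr hpos)
  refine ⟨s i₁, h0, i₁, hi₁, hlt₁, hs _ hlt₁, fun j hj => ?_⟩
  rw [← sub_nonneg]
  rcases lt_or_ge (m i₀) (m j) with h | h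
  · have h1 : (m j - m i₀) • s i₁ ≤ (m j - m i₀) • s j :=
      zsmul_le_zsmul_right (sub_pos.mpr h).le (hmin j (Finset.mem_filter.mpr ⟨hj, h⟩))
    rw [hs _ h, sub_smul, ← sub_nonneg] at h1
    convert h1 using 1
    abel
  · have h1 : 0 ≤ (m i₀ - m j) • s i₁ := zsmul_nonneg h0 (sub_nonneg.mpr h)
    have h2 := add_nonneg h1 (sub_nonneg.mpr (hmax j hj))
    rw [sub_smul] at h2
    convert h2 using 1
    abel

/-- Unless a planar set is contained in a line parallel to `e`, one of its edges has an outer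
normal on the positive side of `e`. -/
theorem exists_edge_normal {ι : Type*} (S : Finset ι) (b₀ b₁ : ι → ℤ) {e₀ e₁ : ℤ}
    (h : ∃ j ∈ S, ∃ j' ∈ S, e₀ * (b₁ j - b₁ j') - e₁ * (b₀ j - b₀ j') ≠ 0) :
    ∃ r₀ r₁ : ℤ, 0 < e₀ * r₀ + e₁ * r₁ ∧ ∃ j ∈ S, ∃ j' ∈ S, j ≠ j' ∧
      (∀ i ∈ S, b₀ i * r₀ + b₁ i * r₁ ≤ b₀ j * r₀ + b₁ j * r₁) ∧
      (∀ i ∈ S, b₀ i * r₀ + b₁ i * r₁ ≤ b₀ j' * r₀ + b₁ j' * r₁) := by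
  classical
  obtain ⟨j, hj, j', hj', hne⟩ := h
  -- The normal is sought on the line e + s(-e₁, e₀), where the product with e is constantly |e|².
  -- On it, index i has value c i + m i * s.
  let c : ι → ℚ := fun i => ((b₀ i * e₀ + b₁ i * e₁ : ℤ) : ℚ)
  let m : ι → ℤ := fun i => b₁ i * e₀ - b₀ i * e₁
  have hdiv : ∀ n : ℤ, 0 < n → ∀ x : ℚ, ∃ y : ℚ, n • y = x := fun n hn x =>
    ⟨x / n, by rw [zsmul_eq_mul]; field_simp⟩
  obtain ⟨j₀, hj₀, hmax⟩ := S.exists_max_image c ⟨j, hj⟩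
  have hex : ∃ j ∈ S, m j ≠ m j₀ := by
    by_contra! hc
    have h1 := hc j hj
    have h2 := hc j' hj'
    simp only [m] at h1 h2
    exact hne (by linear_combination h1 - h2)
  obtain ⟨s, j₁, hj₁, hm₁, heq, hle⟩ : ∃ s : ℚ, ∃ j₁ ∈ S, m j₁ ≠ m j₀ ∧
      c j₁ + m j₁ * s = c j₀ + m j₀ * s ∧ ∀ i ∈ S, c i + m i * s ≤ c j₀ + m j₀ * s := by
    obtain ⟨i, hi, hmi⟩ := hex
    rcases lt_or_gt_of_ne hmi with hlt | hlt
    · obtain ⟨s, -, j₁, hj₁, hm₁, heq, hle⟩ := exists_breakpoint hdiv S c (fun i => -m i) hmax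
        ⟨i, hi, neg_lt_neg hlt⟩
      simp only [zsmul_eq_mul] at heq hle
      push_cast at heq hle
      refine ⟨-s, j₁, hj₁, (neg_lt_neg_iff.mp hm₁).ne, by linarith, fun i hi => ?_⟩
      linarith [hle i hi]
    · obtain ⟨s, -, j₁, hj₁, hm₁, heq, hle⟩ := exists_breakpoint hdiv S c m hmax ⟨i, hi, hlt⟩
      simp only [zsmul_eq_mul] at heq hle
      push_cast at heq
      exact ⟨s, j₁, hj₁, hm₁.ne', by linarith, hle⟩
  have hden : (0 : ℚ) < s.den := by exact_mod_cast s.den_pos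
  have hval : ∀ i, ((b₀ i * (s.den * e₀ - s.num * e₁) + b₁ i * (s.den * e₁ + s.num * e₀) : ℤ) : ℚ)
      = s.den * (c i + m i * s) := by
    intro i
    have hs : (s.num : ℚ) = s.den * s := (Rat.den_mul_eq_num s).symm
    simp only [c, m]
    push_cast
    rw [hs]
    ring
  -- This is the rational normal with its denominator cleared.
  refine ⟨s.den * e₀ - s.num * e₁, s.den * e₁ + s.num * e₀, ?_, j₀, hj₀, j₁, hj₁, ?_, ?_, ?_⟩
  · have hd : (0 : ℤ) < s.den := by exact_mod_cast s.den_pos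
    have hee : 0 < e₀ * e₀ + e₁ * e₁ := by
      by_contra! hc
      have h0 : e₀ = 0 := by nlinarith
      have h1 : e₁ = 0 := by nlinarith
      exact hne (by rw [h0, h1]; ring)
    have := mul_pos hd hee
    linarith
  · rintro rfl
    exact hm₁ rfl
  · intro i hi
    have : (s.den : ℚ) * (c i + m i * s) ≤ s.den * (c j₀ + m j₀ * s) :=
      mul_le_mul_of_nonneg_left (hle i hi) hden.le
    rw [← hval, ← hval] at this
    exact_mod_cast this
  · intro i hi
    have : (s.den : ℚ) * (c i + m i * s) ≤ s.den * (c j₁ + m j₁ * s) :=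
      mul_le_mul_of_nonneg_left ((hle i hi).trans heq.ge) hden.le
    rw [← hval, ← hval] at this
    exact_mod_cast this

variable {Γ : AddSubgroup ℝ}

theorem TropPoly.term_add (f : TropPoly Γ) (i : f.support) (q x : Fin 2 → Γ) :
    f.term i (q + x) = f.term i q + ∑ m, (i : Fin 2 →₀ ℕ) m • x m := by
  simp only [TropPoly.term, Pi.add_apply, smul_add, Finset.sum_add_distrib, add_assoc]

theorem TropPoly.continuous_term (f : TropPoly Γ) (i : f.support) : Continuous (f.term i) := by
  unfold TropPoly.term
  fun_prop

theorem TropPoly.Attains.term_eq {f : TropPoly Γ} {q : Fin 2 → Γ} {i j : f.support}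
    (hi : f.Attains q i) (hj : f.Attains q j) : f.term i q = f.term j q :=
  le_antisymm (hj i) (hi j)

theorem TropPoly.exists_attains (f : TropPoly Γ) (q : Fin 2 → Γ) :
    ∃ i, f.Attains q i := by
  obtain ⟨l, -, hl⟩ := (Finset.univ : Finset f.support).exists_max_image
    (fun i => f.term i q) ⟨⟨_, f.nonempty.choose_spec⟩, Finset.mem_univ _⟩
  exact ⟨l, fun j => hl j (Finset.mem_univ j)⟩

/-- Near `q` only the indices attaining the maximum at `q` matter. -/
theorem TropPoly.eventually_attains (f : TropPoly Γ) (q : Fin 2 → Γ) :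
    ∀ᶠ x in 𝓝 q, ∀ i, f.Attains q i → (∀ j, f.Attains q j → f.term j x ≤ f.term i x) →
      f.Attains x i := by
  have h : ∀ᶠ x in 𝓝 q, ∀ i j, f.term j q < f.term i q → f.term j x < f.term i x := by
    refine Filter.eventually_all.mpr fun i => Filter.eventually_all.mpr fun j => ?_
    by_cases hlt : f.term j q < f.term i q
    · filter_upwards [((f.continuous_term j).tendsto q).eventually_lt
        ((f.continuous_term i).tendsto q) hlt] with x hx _ using hx
    · exact Filter.Eventually.of_forall fun x hx => absurd hx hlt
  filter_upwards [h] with x hx i hi hle j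
  by_cases hj : f.Attains q j
  · exact hle j hj
  · refine (hx i j (lt_of_le_of_ne (hi j) fun e => hj fun l => ?_)).le
    rw [e]
    exact hi l

/-- A point at which the initial supports of `f` and `g` are not contained in parallel lines
belongs to the stable intersection. -/
theorem mem_stableIntersection_of_cross_ne_zero
    (hdiv : ∀ n : ℤ, 0 < n → ∀ x : Γ, ∃ y : Γ, n • y = x) (f g : TropPoly Γ) (q : Fin 2 → Γ)
    {i i' : f.support} {j j' : g.support} (hi : f.Attains q i) (hi' : f.Attains q i')
    (hj : g.Attains q j) (hj' : g.Attains q j') (hc : cross i i' j j' ≠ 0) :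
    q ∈ stableIntersection f.zeros g.zeros := by
  classical
  intro U hU
  refine Filter.Eventually.filter_mono nhdsWithin_le_nhds ?_
  let pair : (Fin 2 →₀ ℕ) → (Fin 2 → Γ) → Γ := fun i x => ∑ m, i m • x m
  have key : ∀ᶠ p in 𝓝 ((0, 0) : (Fin 2 → Γ) × (Fin 2 → Γ)), ∀ i₀ : f.support, f.Attains q i₀ →
      (∀ l : f.support, f.Attains q l → pair l (p.2 - p.1) ≤ pair i₀ (p.2 - p.1)) →
      (translate p.1 f.zeros ∩ translate p.2 g.zeros ∩ U).Nonempty := by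
    -- i₀ is the index leading after the displacement p.2 - p.1. It depends on p, but has finitely
    -- many values, so it may be fixed first.
    refine Filter.eventually_all.mpr fun i₀ => ?_
    by_cases hi₀ : f.Attains q i₀
    swap
    · exact Filter.Eventually.of_forall fun p h => absurd h hi₀
    obtain ⟨i₂, hi₂, hc₂⟩ : ∃ i₂ : f.support, f.Attains q i₂ ∧ cross i₂ i₀ j j' ≠ 0 := by
      by_contra! h
      refine hc ?_
      have h1 := h i hi
      have h2 := h i' hi'
      unfold cross at h1 h2 ⊢
      linear_combination h1 - h2
    -- With e = i₂ - i₀: moving along r keeps j₁ and j₂ tied for g, while i₂ gains on i₀ for f.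
    obtain ⟨r₀, r₁, hr, j₁, hj₁, j₂, hj₂, hj₁₂, hmax₁, hmax₂⟩ :=
      exists_edge_normal (Finset.univ.filter (g.Attains q))
        (fun j => ((j : Fin 2 →₀ ℕ) 0 : ℤ)) (fun j => ((j : Fin 2 →₀ ℕ) 1 : ℤ))
        ⟨j, by simpa using hj, j', by simpa using hj', hc₂⟩
    simp only [Finset.mem_filter, Finset.mem_univ, true_and] at hj₁ hj₂ hmax₁ hmax₂
    let ray : Γ → (Fin 2 → Γ) := fun s => ![r₀ • s, r₁ • s]
    have hray : Continuous ray := by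
      refine continuous_pi fun m => ?_
      fin_cases m
      · exact continuous_id.zsmul r₀
      · exact continuous_id.zsmul r₁
    have hray0 : ray 0 = 0 := by
      ext m; fin_cases m <;> simp [ray]
    let slope : (Fin 2 →₀ ℕ) → ℤ := fun i => i 0 * r₀ + i 1 * r₁
    have pair_ray : ∀ (i : Fin 2 →₀ ℕ) (s : Γ), pair i (ray s) = slope i • s := by
      intro i s
      simp [pair, ray, slope, Fin.sum_univ_two, add_smul, mul_smul]
    have pair_add : ∀ (i : Fin 2 →₀ ℕ) (x y : Fin 2 → Γ), pair i (x + y) = pair i x + pair i y := by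
      intro i x y
      simp only [pair, Pi.add_apply, smul_add, Finset.sum_add_distrib]
    have pair_cont : ∀ i : Fin 2 →₀ ℕ, Continuous (pair i) := by
      intro i
      simp only [pair]
      fun_prop
    have hev : ∀ᶠ z : ((Fin 2 → Γ) × (Fin 2 → Γ)) × Γ in 𝓝 ((0, 0), 0),
        z.1.2 + (q + ray z.2) ∈ U ∧
        (∀ i, f.Attains q i → (∀ l, f.Attains q l →
          f.term l (q + (z.1.2 - z.1.1 + ray z.2)) ≤ f.term i (q + (z.1.2 - z.1.1 + ray z.2))) →
          f.Attains (q + (z.1.2 - z.1.1 + ray z.2)) i) ∧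
        (∀ j, g.Attains q j → (∀ l, g.Attains q l →
          g.term l (q + ray z.2) ≤ g.term j (q + ray z.2)) → g.Attains (q + ray z.2) j) := by
      have c1 : Continuous fun z : ((Fin 2 → Γ) × (Fin 2 → Γ)) × Γ => z.1.2 + (q + ray z.2) := by
        fun_prop
      have c2 : Continuous fun z : ((Fin 2 → Γ) × (Fin 2 → Γ)) × Γ =>
          q + (z.1.2 - z.1.1 + ray z.2) := by
        fun_prop
      have c3 : Continuous fun z : ((Fin 2 → Γ) × (Fin 2 → Γ)) × Γ => q + ray z.2 := by
        fun_prop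
      refine Filter.Eventually.and ?_ (Filter.Eventually.and ?_ ?_)
      · exact c1.tendsto' _ q (by simp [hray0]) hU
      · exact (c2.tendsto' ((0, 0), 0) q (by simp [hray0])).eventually (f.eventually_attains q)
      · exact (c3.tendsto' ((0, 0), 0) q (by simp [hray0])).eventually (g.eventually_attains q)
    rw [nhds_prod_eq, Filter.eventually_prod_iff] at hev
    obtain ⟨V, hV, W, hW, hVW⟩ := hev
    obtain ⟨ε, hε, hball⟩ := Metric.eventually_nhds_iff.mp hW
    have hsmall : ∀ᶠ p in 𝓝 ((0, 0) : (Fin 2 → Γ) × (Fin 2 → Γ)), ∀ l : f.support,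
        ((pair i₀ (p.2 - p.1) - pair l (p.2 - p.1) : Γ) : ℝ) < ε := by
      refine Filter.eventually_all.mpr fun l => ?_
      have c : Continuous fun p : (Fin 2 → Γ) × (Fin 2 → Γ) =>
          ((pair i₀ (p.2 - p.1) - pair l (p.2 - p.1) : Γ) : ℝ) := by
        have := pair_cont i₀
        have := pair_cont l
        fun_prop
      exact (c.tendsto' (0, 0) 0 (by simp [pair])).eventually_lt_const hε
    filter_upwards [hV, hsmall] with p hpV hps _ hpmax
    obtain ⟨s, hs0, i₁, hi₁, hlt, heq, hle⟩ := exists_breakpoint hdiv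
      (Finset.univ.filter (f.Attains q)) (fun i => pair i (p.2 - p.1)) (fun i => slope i)
      (i₀ := i₀) (fun i hi => hpmax i (by simpa using hi))
      ⟨i₂, by simpa using hi₂, by simp only [slope]; linarith⟩
    simp only [Finset.mem_filter, Finset.mem_univ, true_and] at hi₁ hle
    -- The slopes are integers, so their difference is at least 1 and s is bounded by the small gap
    -- created by the translation.
    have hsε : (s : ℝ) < ε := by
      refine lt_of_le_of_lt ?_ (hps i₁)
      rw [← heq]
      have h1 : (1 : ℤ) • s ≤ (slope i₁ - slope i₀) • s :=
        zsmul_le_zsmul_left hs0 (by omega)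
      rw [one_smul] at h1
      exact_mod_cast h1
    have hsW : W s := hball (by
      rw [Subtype.dist_eq, Real.dist_eq]
      have : (0 : ℝ) ≤ s := hs0
      simpa [abs_of_nonneg this] using hsε)
    obtain ⟨hxU, hxf, hxg⟩ := hVW hpV hsW
    have termf : ∀ l, f.term l (q + (p.2 - p.1 + ray s)) =
        f.term l q + (pair l (p.2 - p.1) + slope l • s) := by
      intro l
      rw [f.term_add, ← pair_ray, ← pair_add]
    have termg : ∀ l, g.term l (q + ray s) = g.term l q + slope l • s := by
      intro l
      rw [g.term_add, ← pair_ray]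
    have e₁ : pair i₁ (p.2 - p.1) + slope i₁ • s = pair i₀ (p.2 - p.1) + slope i₀ • s := by
      rw [sub_smul] at heq
      have := sub_eq_sub_iff_add_eq_add.mp heq
      rw [add_comm, this]
    -- The meeting point is p.2 + q + s·r: subtracting p.2 gives a point on the ray in 𝒯(g),
    -- subtracting p.1 the breakpoint of f.
    refine ⟨p.2 + (q + ray s), ⟨⟨q + (p.2 - p.1 + ray s), ?_, by simp only; abel⟩,
      q + ray s, ?_, rfl⟩, hxU⟩
    · refine ⟨i₀, i₁, fun e => by simp [e] at hlt, hxf _ hi₀ fun l hl => ?_,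
        hxf _ hi₁ fun l hl => ?_⟩
      · simp only
        rw [termf, termf, hl.term_eq hi₀]
        exact add_le_add_right (hle l hl) _
      · simp only
        rw [termf, termf, hl.term_eq hi₁, e₁]
        exact add_le_add_right (hle l hl) _
    · refine ⟨j₁, j₂, hj₁₂, hxg _ hj₁ fun l hl => ?_, hxg _ hj₂ fun l hl => ?_⟩
      · rw [termg, termg, hl.term_eq hj₁]
        exact add_le_add_right (zsmul_le_zsmul_left hs0 (hmax₁ l hl)) _
      · rw [termg, termg, hl.term_eq hj₂]
        exact add_le_add_right (zsmul_le_zsmul_left hs0 (hmax₂ l hl)) _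
  filter_upwards [key] with p hp
  obtain ⟨i₀, hi₀, hmax⟩ := (Finset.univ.filter (f.Attains q)).exists_max_image
    (fun l => pair l (p.2 - p.1)) ⟨i, by simpa using hi⟩
  exact hp i₀ (by simpa using hi₀) fun l hl => hmax l (by simpa using hl)

end Geometry

/-! ### Reduction to the residue field -/

section Reduction

variable {K : Type*} [Field K] {v : AddValuation K (WithTop ℝ)}

theorem val_eq_neg_trop (x : Kˣ) : v (x : K) = ((-(trop v x) : valueGroup v) : ℝ) := by
  simp [trop]

theorem trop_mul (x y : Kˣ) : trop v (x * y) = trop v x + trop v y := by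
  have h := val_eq_neg_trop (v := v) (x * y)
  rw [Units.val_mul, v.map_mul, val_eq_neg_trop x, val_eq_neg_trop y, ← WithTop.coe_add,
    WithTop.coe_inj] at h
  apply Subtype.ext
  push_cast at h ⊢
  linarith

theorem trop_pow (x : Kˣ) (n : ℕ) : trop v (x ^ n) = n • trop v x := by
  induction n with
  | zero =>
    have h := trop_mul (v := v) 1 1
    rw [mul_one, left_eq_add] at h
    simpa using h
  | succ n ih => rw [pow_succ, trop_mul, ih, succ_nsmul]

/-- The value group of an algebraically closed field is divisible. -/
theorem valueGroup_divisible [IsAlgClosed K] (n : ℤ) (hn : 0 < n) (γ : valueGroup v) :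
    ∃ δ : valueGroup v, n • δ = γ := by
  obtain ⟨r, x, hx⟩ := γ
  have hx0 : x ≠ 0 := by
    rintro rfl
    simp at hx
  lift n to ℕ using hn.le
  obtain ⟨z, hz⟩ := IsAlgClosed.exists_pow_nat_eq x (by exact_mod_cast hn : 0 < n)
  have hz0 : z ≠ 0 := by
    rintro rfl
    rw [zero_pow (by omega)] at hz
    exact hx0 hz.symm
  refine ⟨-trop v (Units.mk0 z hz0), ?_⟩
  have h := val_eq_neg_trop (v := v) (Units.mk0 z hz0 ^ n)
  rw [trop_pow] at h
  simp only [Units.val_pow_eq_pow_val, Units.val_mk0, hz, hx, WithTop.coe_inj] at h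
  apply Subtype.ext
  simp only [h]
  simp

/-- The part of valuation `0` of a non-zero element. -/
noncomputable def unitPart (M : MonomialGroup v) (x : Kˣ) : valuationRing v :=
  ⟨_, unitPart_mem M x⟩

theorem principalCoeff_eq (M : MonomialGroup v) (x : Kˣ) :
    principalCoeff M (x : K) = IsLocalRing.residue (valuationRing v) (unitPart M x) := by
  rw [principalCoeff, dif_neg x.ne_zero]
  congr 2

theorem val_mul_t (M : MonomialGroup v) (x : Kˣ) (γ : valueGroup v) :
    v ((x : K) * M.t (Multiplicative.ofAdd γ)) = ((γ - trop v x : valueGroup v) : ℝ) := by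
  rw [v.map_mul, M.val_t, val_eq_neg_trop, ← WithTop.coe_add, WithTop.coe_inj]
  push_cast
  ring

/-- Elements of positive valuation have residue `0`, and conversely. -/
theorem residue_eq_zero_iff_val_pos (x : valuationRing v) :
    IsLocalRing.residue (valuationRing v) x = 0 ↔ 0 < v (x : K) := by
  rw [IsLocalRing.residue_eq_zero_iff, IsLocalRing.mem_maximalIdeal, mem_nonunits_iff, ← not_le,
    not_iff_not]
  constructor
  · rintro ⟨u, rfl⟩
    have h1 : (0 : WithTop ℝ) ≤ v ((u⁻¹ : (valuationRing v)ˣ) : valuationRing v) :=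
      (u⁻¹ : (valuationRing v)ˣ).1.2
    have h2 : v ((u : valuationRing v) : K) + v ((u⁻¹ : (valuationRing v)ˣ) : valuationRing v)
        = 0 := by
      rw [← v.map_mul, ← MulMemClass.coe_mul, Units.mul_inv]
      simp
    calc v ((u : valuationRing v) : K)
        ≤ v ((u : valuationRing v) : K) + v ((u⁻¹ : (valuationRing v)ˣ) : valuationRing v) :=
          le_add_of_nonneg_right h1
      _ = 0 := h2
  · intro h
    have hx0 : (x : K) ≠ 0 := by
      intro h0
      rw [h0, v.map_zero] at h
      simp at h
    have hv0 : v (x : K) = 0 := le_antisymm h x.2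
    refine IsUnit.of_mul_eq_one (⟨(x : K)⁻¹, ?_⟩ : valuationRing v) ?_
    · change 0 ≤ v _
      rw [v.map_inv, hv0]
      exact neg_zero.ge
    · exact Subtype.ext (mul_inv_cancel₀ hx0)

/-- Multiplication by t^T(x) brings x to valuation exactly 0. This places Pc(x) in the torus over k,
as the elimination requires. -/
theorem principalCoeff_ne_zero (M : MonomialGroup v) (x : Kˣ) :
    principalCoeff M (x : K) ≠ 0 := by
  rw [principalCoeff_eq, Ne, residue_eq_zero_iff_val_pos]
  change ¬ 0 < v ((x : K) * M.t (Multiplicative.ofAdd (trop v x)))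
  rw [val_mul_t, sub_self]
  simp

open Classical in
/-- If a lift of `f` vanishes at `x`, then its initial form at `T(x)` vanishes at the principal
coefficients of `x`. -/
theorem sum_principalCoeff_eq_zero (M : MonomialGroup v) (f : TropPoly (valueGroup v))
    (F : MvPolynomial (Fin 2) K) (hF : IsLift v f F) (x : Fin 2 → Kˣ) (hx : x ∈ torusCurve F) :
    ∑ i ∈ Finset.univ.filter (f.Attains (tropPoint v x)), principalCoeff M (F.coeff i) *
      ∏ m, principalCoeff M (x m : K) ^ (i : Fin 2 →₀ ℕ) m = 0 := by
  have hne : ∀ i : f.support, F.coeff i ≠ 0 := fun i =>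
    MvPolynomial.mem_support_iff.mp (by rw [hF.1]; exact i.2)
  let a : f.support → Kˣ := fun i => Units.mk0 _ (hne i)
  have ha : ∀ i, trop v (a i) = f.coeff i := fun i => hF.2 i (a i) rfl
  obtain ⟨l, hl⟩ := f.exists_attains (tropPoint v x)
  set μ := f.term l (tropPoint v x)
  let w : f.support → Kˣ := fun i => a i * (x 0 ^ (i : Fin 2 →₀ ℕ) 0 * x 1 ^ (i : Fin 2 →₀ ℕ) 1)
  have hw : ∀ i, trop v (w i) = f.term i (tropPoint v x) := by
    intro i
    simp only [w, trop_mul, trop_pow, ha, TropPoly.term, Fin.sum_univ_two, tropPoint]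
  -- Multiplying F(x) = 0 by t^μ, with μ the tropical maximum, makes every term integral; exactly
  -- the maximal terms survive reduction.
  have hmem : ∀ i, (w i : K) * M.t (Multiplicative.ofAdd μ) ∈ valuationRing v := by
    intro i
    change 0 ≤ v _
    rw [val_mul_t, hw]
    exact WithTop.coe_le_coe.mpr (sub_nonneg.mpr (hl i))
  let b : f.support → valuationRing v := fun i => ⟨_, hmem i⟩
  have hsum : ∑ i, b i = 0 := by
    apply Subtype.ext
    have h : MvPolynomial.eval (fun m => (x m : K)) F = 0 := hx
    rw [MvPolynomial.eval_eq', hF.1, ← Finset.sum_coe_sort] at h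
    have h' := congrArg (· * (M.t (Multiplicative.ofAdd μ) : K)) h
    simp only [Finset.sum_mul, zero_mul] at h'
    rw [AddSubmonoidClass.coe_finsetSum]
    simpa [b, w, a, Fin.prod_univ_two] using h'
  have hres := congrArg (IsLocalRing.residue (valuationRing v)) hsum
  rw [map_sum, map_zero] at hres
  rw [← hres, Finset.sum_filter]
  refine Finset.sum_congr rfl fun i _ => ?_
  have hatt : f.Attains (tropPoint v x) i ↔ f.term i (tropPoint v x) = μ :=
    ⟨fun h => le_antisymm (hl i) (h l),
      fun h j => by rw [h]; exact hl j⟩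
  split_ifs with hi
  · rw [hatt] at hi
    -- Since γ ↦ t^γ is a homomorphism, t^μ splits into the normalizing factors of the coefficient
    -- and of the coordinates.
    have hb : b i = unitPart M (a i) * ∏ m, unitPart M (x m) ^ (i : Fin 2 →₀ ℕ) m := by
      apply Subtype.ext
      change (w i : K) * M.t (Multiplicative.ofAdd μ) = _
      rw [← hi, TropPoly.term, Fin.prod_univ_two, Fin.sum_univ_two, ← ha]
      simp only [unitPart, MulMemClass.coe_mul, SubmonoidClass.coe_pow, w, Units.val_mul,
        Units.val_pow_eq_pow_val, ofAdd_add, ofAdd_nsmul, map_mul, map_pow, tropPoint]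
      ring
    rw [hb, map_mul, map_prod, ← principalCoeff_eq]
    simp only [map_pow, ← principalCoeff_eq]
    rfl
  · symm
    rw [residue_eq_zero_iff_val_pos]
    change 0 < v ((w i : K) * M.t (Multiplicative.ofAdd μ))
    rw [val_mul_t, hw]
    refine WithTop.coe_lt_coe.mpr (sub_pos.mpr (lt_of_le_of_ne (hl i) ?_))
    exact fun h => hi (hatt.mpr (Subtype.ext h))

/-- For lifts with residually generic coefficients, the intersection of the algebraic curves
projects into the stable intersection of the tropical curves. -/
theorem exists_tropPoint_image_subset_stableIntersection [IsAlgClosed K] (M : MonomialGroup v)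
    (f g : TropPoly (valueGroup v)) :
    ∃ P : MvPolynomial (f.support ⊕ g.support) (ResidueField v), P ≠ 0 ∧
      ∀ F G : MvPolynomial (Fin 2) K,
        IsLift v f F → IsLift v g G →
        MvPolynomial.eval (residualCoeffs M f.support g.support F G) P ≠ 0 →
        tropPoint v '' (torusCurve F ∩ torusCurve G) ⊆
          stableIntersection f.zeros g.zeros := by
  classical
  -- P may not depend on q, so every pair of subsets of the supports gets a factor; pairs that are
  -- not parallel or have an empty member get 1.
  have key : ∀ S : Finset f.support × Finset g.support,
      ∃ P : MvPolynomial (f.support ⊕ g.support) (ResidueField v), P ≠ 0 ∧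
        (S.1.Nonempty → S.2.Nonempty →
          (∀ i ∈ S.1, ∀ i' ∈ S.1, ∀ j ∈ S.2, ∀ j' ∈ S.2, cross i i' j j' = 0) →
          ∀ (a : f.support ⊕ g.support → ResidueField v) (y : Fin 2 → ResidueField v),
            (∀ m, y m ≠ 0) →
            ∑ i ∈ S.1, a (Sum.inl i) * ∏ m, y m ^ (i : Fin 2 →₀ ℕ) m = 0 →
            ∑ j ∈ S.2, a (Sum.inr j) * ∏ m, y m ^ (j : Fin 2 →₀ ℕ) m = 0 →
              MvPolynomial.eval a P = 0) := by
    rintro ⟨A, B⟩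
    by_cases h : A.Nonempty ∧ B.Nonempty ∧
        ∀ i ∈ A, ∀ i' ∈ A, ∀ j ∈ B, ∀ j' ∈ B, cross i i' j j' = 0
    · obtain ⟨P, hP, hP'⟩ := exists_ne_zero_of_common_zero (k := ResidueField v) A B h.1 h.2.1 h.2.2
      exact ⟨P, hP, fun _ _ _ => hP'⟩
    · exact ⟨1, one_ne_zero, fun h₁ h₂ h₃ => absurd ⟨h₁, h₂, h₃⟩ h⟩
  choose P hP hP' using key
  refine ⟨∏ S, P S, Finset.prod_ne_zero_iff.mpr fun S _ => hP S, ?_⟩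
  rintro F G hF hG hPne _ ⟨x, ⟨hxF, hxG⟩, rfl⟩
  set q := tropPoint v x
  by_contra hnot
  have hpar : ∀ i, f.Attains q i → ∀ i', f.Attains q i' → ∀ j, g.Attains q j →
      ∀ j', g.Attains q j' → cross i i' j j' = 0 := by
    intro i hi i' hi' j hj j' hj'
    by_contra hc
    exact hnot (mem_stableIntersection_of_cross_ne_zero valueGroup_divisible f g q hi hi' hj hj' hc)
  obtain ⟨i, hi⟩ := f.exists_attains q
  obtain ⟨j, hj⟩ := g.exists_attains q
  rw [map_prod] at hPne
  refine Finset.prod_ne_zero_iff.mp hPne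
    (Finset.univ.filter (f.Attains q), Finset.univ.filter (g.Attains q)) (Finset.mem_univ _) ?_
  refine hP' _ ⟨i, by simpa using hi⟩ ⟨j, by simpa using hj⟩ (by simpa using hpar) _
    (fun m => principalCoeff M (x m : K)) (fun m => principalCoeff_ne_zero M _) ?_ ?_
  · exact sum_principalCoeff_eq_zero M f F hF x hxF
  · exact sum_principalCoeff_eq_zero M g G hG x hxG

end Reduction

end TropicalPlane

theorem mainTheorem5 {K : Type*} [Field K] [IsAlgClosed K]
    (v : AddValuation K (WithTop ℝ)) (hv : ∃ x : K, x ≠ 0 ∧ v x ≠ 0)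
    (M : TropicalPlane.MonomialGroup v)
    (f g : TropicalPlane.TropPoly (TropicalPlane.valueGroup v)) :
    ∃ P : MvPolynomial (f.support ⊕ g.support) (TropicalPlane.ResidueField v), P ≠ 0 ∧
      ∀ F G : MvPolynomial (Fin 2) K,
        TropicalPlane.IsLift v f F → TropicalPlane.IsLift v g G →
        MvPolynomial.eval (TropicalPlane.residualCoeffs M f.support g.support F G) P ≠ 0 →
        TropicalPlane.tropPoint v '' (TropicalPlane.torusCurve F ∩ TropicalPlane.torusCurve G) ⊆
          TropicalPlane.stableIntersection f.zeros g.zeros :=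
  TropicalPlane.exists_tropPoint_image_subset_stableIntersection M f g
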